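/- Let $F$ be a field, $n$ a natural number, and $A_n=F[x_1,\ldots,x_n]$. Automorphisms of the $F$-algebra $A_n$ are multiplied by composition, $(\varphi\psi)(p)=\varphi(\psi(p))$. Let $Af_n(F)$ be the group of affine automorphisms of $A_n$, i.e. of those automorphisms $\varphi$ for which every $\varphi(x_i)$ has degree at most $1$. For $1\le i\le n$, $0\neq\alpha\in F$ and $f\in F[X\setminus\{x_i\}]$, where $X=\{x_1,\ldots,x_n\}$, let $$\sigma(i,\alpha,f)=(x_1,\ldots,x_{i-1},\alpha x_i+f,x_{i+1},\ldots,x_n)$$ be the elementary automorphism sending $x_i$ to $\alpha x_i+f$ and fixing all other variables; it is affine exactly when $\deg f\le 1$. For $k\neq s$ put $$(ks)=\sigma(s,-1,x_k)\,\sigma(k,1,-x_s)\,\sigma(s,1,x_k),$$ which as an automorphism interchanges $x_k$ and $x_s$ and fixes the other variables. Then the group $Af_n(F)$ is presented by the generators $\sigma(i,\alpha,f)$ with $1\le i\le n$, $0\ne\alpha\in F$, $f\in F[X\setminus\{x_i\}]$, $\deg f\le 1$, and the following defining relations, where all $\sigma$'s are elementary affine: 1. $\sigma(i,\alpha,f)\,\sigma(i,\beta,g)=\sigma(i,\alpha\beta,\beta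 f+g)$; 2. $\sigma(i,\alpha,f)^{-1}\sigma(j,\beta,g)\,\sigma(i,\alpha,f)=\sigma\bigl(j,\beta,\sigma(i,\alpha,f)^{-1}(g)\bigr)$ if $i\neq j$ and $f\in F[X\setminus\{x_i,x_j\}]$; 3. $(ks)^{-1}\sigma(i,\alpha,f)\,(ks)=\sigma\bigl(j,\alpha,(ks)(f)\bigr)$ if $k\neq s$ and $x_j=(ks)(x_i)$, where $(ks)$ denotes the word displayed above. That is, the abstract group on the symbols $\sigma(i,\alpha,f)$ of elementary affine automorphisms with the relations 1–3 is isomorphic to $Af_n(F)$, by an isomorphism sending each symbol to the automorphism it denotes. -/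

import Mathlib

noncomputable section

namespace AffinePresentation

open MvPolynomial

variable {n : ℕ} {F : Type*} [Field F]

/-- `f` is a polynomial of degree at most one that does not involve the variable `x_i`. -/
structure IsAffineOff (i : Fin n) (f : MvPolynomial (Fin n) F) : Prop where
  mem_supported : f ∈ supported F ({i}ᶜ : Set (Fin n))
  totalDegree_le : f.totalDegree ≤ 1

/-- A substitution that is trivial on the variables in `s` fixes every polynomial in them. -/
theorem aeval_eq_self {s : Set (Fin n)} {v : Fin n → MvPolynomial (Fin n) F}
    (hv : ∀ j ∈ s, v j = X j) {f : MvPolynomial (Fin n) F} (hf : f ∈ supported F s) :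
    aeval v f = f := by
  rw [supported_eq_adjoin_X] at hf
  induction hf using Algebra.adjoin_induction with
  | mem x hx => obtain ⟨j, hj, rfl⟩ := hx; simp [hv j hj]
  | algebraMap r => simp [algebraMap_eq]
  | add x y _ _ hx hy => rw [map_add, hx, hy]
  | mul x y _ _ hx hy => rw [map_mul, hx, hy]

/-- The elementary automorphism `σ(i, α, f) = (x_1, …, x_{i-1}, α x_i + f, x_{i+1}, …, x_n)` of
`F[x_1, …, x_n]`, for `α ≠ 0` and `f` a polynomial in the variables other than `x_i`. -/
def elemAut (i : Fin n) (α : Fˣ) (f : MvPolynomial (Fin n) F)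
    (hf : f ∈ supported F ({i}ᶜ : Set (Fin n))) :
    MvPolynomial (Fin n) F ≃ₐ[F] MvPolynomial (Fin n) F :=
  AlgEquiv.ofAlgHom
    (aeval (Function.update X i (C (α : F) * X i + f)))
    (aeval (Function.update X i (C ((α⁻¹ : Fˣ) : F) * (X i - f))))
    (by
      ext1 j
      rcases eq_or_ne j i with rfl | h
      · have h1 : aeval (Function.update X j (C (α : F) * X j + f)) f = f :=
          aeval_eq_self (fun k hk => Function.update_of_ne hk _ _) hf
        have h2 : (C ((α⁻¹ : Fˣ) : F) * C (α : F) : MvPolynomial (Fin n) F) = 1 := by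
          rw [← C_mul]; simp
        simp only [AlgHom.comp_apply, aeval_X, Function.update_self, map_mul, map_sub, h1,
          add_sub_cancel_right, AlgHom.id_apply, algHom_C, algebraMap_eq]
        rw [← mul_assoc, h2, one_mul]
      · simp [Function.update_of_ne h])
    (by
      ext1 j
      rcases eq_or_ne j i with rfl | h
      · have h1 : aeval (Function.update X j (C ((α⁻¹ : Fˣ) : F) * (X j - f))) f = f :=
          aeval_eq_self (fun k hk => Function.update_of_ne hk _ _) hf
        have h2 : (C (α : F) * C ((α⁻¹ : Fˣ) : F) : MvPolynomial (Fin n) F) = 1 := by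
          rw [← C_mul]; simp
        simp only [AlgHom.comp_apply, aeval_X, Function.update_self, map_mul, map_add, h1,
          AlgHom.id_apply, algHom_C, algebraMap_eq]
        rw [← mul_assoc, h2, one_mul, sub_add_cancel]
      · simp [Function.update_of_ne h])

theorem elemAut_apply (i : Fin n) (α : Fˣ) (f : MvPolynomial (Fin n) F)
    (hf : f ∈ supported F ({i}ᶜ : Set (Fin n))) (p : MvPolynomial (Fin n) F) :
    elemAut i α f hf p = aeval (Function.update X i (C (α : F) * X i + f)) p := rfl

theorem elemAut_inv_apply (i : Fin n) (α : Fˣ) (f : MvPolynomial (Fin n) F)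
    (hf : f ∈ supported F ({i}ᶜ : Set (Fin n))) (p : MvPolynomial (Fin n) F) :
    (elemAut i α f hf)⁻¹ p
      = aeval (Function.update X i (C ((α⁻¹ : Fˣ) : F) * (X i - f))) p := rfl

/-- Substituting polynomials of degree at most one into one of degree at most one. -/
theorem totalDegree_aeval_le {v : Fin n → MvPolynomial (Fin n) F}
    (hv : ∀ j, (v j).totalDegree ≤ 1) {p : MvPolynomial (Fin n) F} (hp : p.totalDegree ≤ 1) :
    (aeval v p).totalDegree ≤ 1 := by
  rw [aeval_def, eval₂_eq]
  refine totalDegree_finsetSum_le fun d hd => ?_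
  refine (totalDegree_mul _ _).trans ?_
  rw [algebraMap_eq, totalDegree_C, zero_add]
  refine (totalDegree_finsetProd _ _).trans ?_
  refine le_trans (Finset.sum_le_sum fun j _ => ?_) ((le_totalDegree hd).trans hp)
  exact (totalDegree_pow _ _).trans (by simpa using Nat.mul_le_mul_left (d j) (hv j))

theorem totalDegree_C_mul_le (c : F) (p : MvPolynomial (Fin n) F) :
    (C c * p).totalDegree ≤ p.totalDegree := by
  rw [← smul_eq_C_mul]; exact totalDegree_smul_le _ _

theorem C_mul_mem (c : F) {s : Set (Fin n)} {p : MvPolynomial (Fin n) F}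
    (hp : p ∈ supported F s) : C c * p ∈ supported F s := by
  rw [← smul_eq_C_mul]; exact Subalgebra.smul_mem _ hp c

/-- An algebra homomorphism carries `F[x_j : j ∈ s]` into any subalgebra containing the images
of these variables. -/
theorem aeval_mem {s : Set (Fin n)} {S : Subalgebra F (MvPolynomial (Fin n) F)}
    {v : Fin n → MvPolynomial (Fin n) F} (hv : ∀ j ∈ s, v j ∈ S)
    {f : MvPolynomial (Fin n) F} (hf : f ∈ supported F s) : aeval v f ∈ S := by
  rw [supported_eq_adjoin_X] at hf
  induction hf using Algebra.adjoin_induction with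
  | mem x hx => obtain ⟨j, hj, rfl⟩ := hx; simpa using hv j hj
  | algebraMap r => simpa [algebraMap_eq] using S.algebraMap_mem r
  | add x y _ _ hx hy => simpa using S.add_mem hx hy
  | mul x y _ _ hx hy => simpa using S.mul_mem hx hy

/-- The second parameter `β f + g` of the product `σ(i, α, f) σ(i, β, g)` is admissible. -/
theorem IsAffineOff.mul_add {i : Fin n} {f g : MvPolynomial (Fin n) F} (hf : IsAffineOff i f)
    (hg : IsAffineOff i g) (β : F) : IsAffineOff i (C β * f + g) :=
  ⟨add_mem (C_mul_mem β hf.1) hg.1,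
    (totalDegree_add _ _).trans (max_le ((totalDegree_C_mul_le _ _).trans hf.2) hg.2)⟩

/-- The polynomial `σ(i, α, f)⁻¹(g)` is admissible for the index `j` if `g` is, and if `i ≠ j`
and `f` does not involve `x_j`. -/
theorem IsAffineOff.conj {i j : Fin n} (hij : i ≠ j) (α : Fˣ) {f g : MvPolynomial (Fin n) F}
    (hf : IsAffineOff i f) (hfj : f ∈ supported F ({i, j}ᶜ : Set (Fin n)))
    (hg : IsAffineOff j g) : IsAffineOff j ((elemAut i α f hf.1)⁻¹ g) := by
  rw [elemAut_inv_apply]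
  constructor
  · refine aeval_mem (fun k hk => ?_) hg.1
    rcases eq_or_ne k i with rfl | h
    · rw [Function.update_self]
      refine C_mul_mem _ (sub_mem (X_mem_supported.2 (by simpa using hij)) ?_)
      exact supported_mono (by simp) hfj
    · rw [Function.update_of_ne h]
      exact X_mem_supported.2 hk
  · refine totalDegree_aeval_le (fun k => ?_) hg.2
    rcases eq_or_ne k i with rfl | h
    · rw [Function.update_self]
      refine (totalDegree_C_mul_le _ _).trans ((totalDegree_sub _ _).trans ?_)
      exact max_le (totalDegree_X _).le hf.2
    · rw [Function.update_of_ne h]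
      exact (totalDegree_X _).le

theorem isAffineOff_X {k s : Fin n} (h : k ≠ s) : IsAffineOff s (X k : MvPolynomial (Fin n) F) :=
  ⟨X_mem_supported.2 (by simpa using h), (totalDegree_X _).le⟩

theorem IsAffineOff.neg {i : Fin n} {f : MvPolynomial (Fin n) F} (hf : IsAffineOff i f) :
    IsAffineOff i (-f) :=
  ⟨neg_mem hf.1, by rw [totalDegree_neg]; exact hf.2⟩

/-- The symbols `σ(i, α, f)` of the elementary affine automorphisms: `0 ≠ α ∈ F`, and `f` is a
polynomial of degree at most one in the variables other than `x_i`. -/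
structure AffineSymbol (n : ℕ) (F : Type*) [Field F] where
  idx : Fin n
  scale : Fˣ
  poly : MvPolynomial (Fin n) F
  isAffineOff : IsAffineOff idx poly

/-- The elementary affine automorphism denoted by a symbol. -/
def AffineSymbol.toAut (a : AffineSymbol n F) :
    MvPolynomial (Fin n) F ≃ₐ[F] MvPolynomial (Fin n) F :=
  elemAut a.idx a.scale a.poly a.isAffineOff.1

/-- The symbol `σ(i, α, f)` as a generator of the free group on all symbols. -/
def gen (i : Fin n) (α : Fˣ) (f : MvPolynomial (Fin n) F) (hf : IsAffineOff i f) :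
    FreeGroup (AffineSymbol n F) :=
  FreeGroup.of ⟨i, α, f, hf⟩

/-- The word `(ks) = σ(s, -1, x_k) σ(k, 1, -x_s) σ(s, 1, x_k)`, for `k ≠ s`. -/
def swapWord (F : Type*) [Field F] (k s : Fin n) (h : k ≠ s) : FreeGroup (AffineSymbol n F) :=
  gen s (-1) (X k) (isAffineOff_X h) * gen k 1 (-X s) (isAffineOff_X h.symm).neg *
    gen s 1 (X k) (isAffineOff_X h)

/-- The automorphism `(ks)` of `F[x_1, …, x_n]`, the value of the word `(ks)`.
The product of automorphisms is composition, `(φψ)(p) = φ(ψ(p))`. -/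
def swapAut (F : Type*) [Field F] (k s : Fin n) (h : k ≠ s) :
    MvPolynomial (Fin n) F ≃ₐ[F] MvPolynomial (Fin n) F :=
  FreeGroup.lift AffineSymbol.toAut (swapWord F k s h)

theorem swapAut_X {k s : Fin n} (h : k ≠ s) (i : Fin n) :
    swapAut F k s h (X i) = X (Equiv.swap k s i) := by
  simp only [swapAut, swapWord, gen, map_mul, FreeGroup.lift_apply_of, AffineSymbol.toAut,
    AlgEquiv.mul_apply, elemAut_apply, aeval_X]
  rcases eq_or_ne i s with rfl | his
  · simp [Function.update_of_ne h, Function.update_of_ne h.symm]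
  · rcases eq_or_ne i k with rfl | hik
    · simp [Function.update_of_ne h]
    · simp [Function.update_of_ne his, Function.update_of_ne hik,
        Equiv.swap_apply_of_ne_of_ne hik his]

theorem swapAut_eq_aeval {k s : Fin n} (h : k ≠ s) (p : MvPolynomial (Fin n) F) :
    swapAut F k s h p = aeval (fun i => X (Equiv.swap k s i)) p := by
  have : (swapAut F k s h : MvPolynomial (Fin n) F →ₐ[F] MvPolynomial (Fin n) F)
      = aeval (fun i => X (Equiv.swap k s i)) := by
    ext1 i; simp [swapAut_X]
  exact DFunLike.congr_fun this p

/-- If `f` is admissible for `i` and `x_j = (ks)(x_i)`, then `(ks)(f)` is admissible for `j`. -/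
theorem IsAffineOff.swap {k s : Fin n} (h : k ≠ s) {i j : Fin n} {f : MvPolynomial (Fin n) F}
    (hf : IsAffineOff i f) (hj : swapAut F k s h (X i) = X j) :
    IsAffineOff j (swapAut F k s h f) := by
  rw [swapAut_X] at hj
  obtain rfl := X_injective hj
  rw [swapAut_eq_aeval]
  refine ⟨aeval_mem (fun l hl => X_mem_supported.2 ?_) hf.1,
    totalDegree_aeval_le (fun l => (totalDegree_X _).le) hf.2⟩
  simpa using hl

/-- The three families of relations between the symbols of elementary affine automorphisms. -/
inductive Rel (n : ℕ) (F : Type*) [Field F] :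
    FreeGroup (AffineSymbol n F) → FreeGroup (AffineSymbol n F) → Prop
  /-- `σ(i, α, f) σ(i, β, g) = σ(i, αβ, βf + g)`. -/
  | mul (i : Fin n) (α β : Fˣ) (f g : MvPolynomial (Fin n) F)
      (hf : IsAffineOff i f) (hg : IsAffineOff i g) :
      Rel n F (gen i α f hf * gen i β g hg)
        (gen i (α * β) (C (β : F) * f + g) (hf.mul_add hg β))
  /-- `σ(i, α, f)⁻¹ σ(j, β, g) σ(i, α, f) = σ(j, β, σ(i, α, f)⁻¹(g))`
  for `i ≠ j` and `f` involving neither `x_i` nor `x_j`. -/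
  | conj (i j : Fin n) (hij : i ≠ j) (α β : Fˣ) (f g : MvPolynomial (Fin n) F)
      (hf : IsAffineOff i f) (hg : IsAffineOff j g)
      (hfj : f ∈ supported F ({i, j}ᶜ : Set (Fin n))) :
      Rel n F ((gen i α f hf)⁻¹ * gen j β g hg * gen i α f hf)
        (gen j β ((elemAut i α f hf.1)⁻¹ g) (IsAffineOff.conj hij α hf hfj hg))
  /-- `(ks)⁻¹ σ(i, α, f) (ks) = σ(j, α, (ks)(f))` for `k ≠ s` and `x_j = (ks)(x_i)`. -/
  | swap (k s : Fin n) (h : k ≠ s) (i j : Fin n) (α : Fˣ) (f : MvPolynomial (Fin n) F)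
      (hf : IsAffineOff i f) (hj : swapAut F k s h (X i) = X j) :
      Rel n F ((swapWord F k s h)⁻¹ * gen i α f hf * swapWord F k s h)
        (gen j α (swapAut F k s h f) (hf.swap h hj))

/-- The relators `u v⁻¹` of the relations `u = v`. -/
def relators (n : ℕ) (F : Type*) [Field F] : Set (FreeGroup (AffineSymbol n F)) :=
  {r | ∃ u v, Rel n F u v ∧ r = u * v⁻¹}

theorem algEquiv_eq_aeval (φ : MvPolynomial (Fin n) F ≃ₐ[F] MvPolynomial (Fin n) F)
    (p : MvPolynomial (Fin n) F) : φ p = aeval (fun j => φ (X j)) p := by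
  have : (φ : MvPolynomial (Fin n) F →ₐ[F] MvPolynomial (Fin n) F)
      = aeval (fun j => φ (X j)) := by
    ext1 i; simp
  exact DFunLike.congr_fun this p

/-- The group of affine automorphisms of `F[x_1, …, x_n]`: the automorphisms that send every
variable to a polynomial of degree at most one. -/
def affineGroup (n : ℕ) (F : Type*) [Field F] :
    Subgroup (MvPolynomial (Fin n) F ≃ₐ[F] MvPolynomial (Fin n) F) where
  carrier := {φ | ∀ i, (φ (X i)).totalDegree ≤ 1}
  one_mem' i := (totalDegree_X i).le
  mul_mem' {φ ψ} hφ hψ i := by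
    have h := algEquiv_eq_aeval φ
    rw [AlgEquiv.mul_apply, h]
    exact totalDegree_aeval_le hφ (hψ i)
  inv_mem' {φ} hφ i := by
    have h := algEquiv_eq_aeval φ
    have hm : ∀ p ∈ restrictTotalDegree (Fin n) F 1,
        φ.toLinearMap p ∈ restrictTotalDegree (Fin n) F 1 := fun p hp => by
      rw [mem_restrictTotalDegree] at hp ⊢
      rw [AlgEquiv.toLinearMap_apply, h]
      exact totalDegree_aeval_le hφ hp
    have hinj : Function.Injective (φ.toLinearMap.restrict hm) := fun p q hpq =>
      Subtype.ext (φ.injective (congrArg Subtype.val hpq))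
    obtain ⟨p, hp⟩ := LinearMap.injective_iff_surjective.1 hinj
      ⟨X i, (mem_restrictTotalDegree _ _ _).2 (totalDegree_X i).le⟩
    have hp' : φ p.1 = X i := congrArg Subtype.val hp
    have : (φ⁻¹ : MvPolynomial (Fin n) F ≃ₐ[F] MvPolynomial (Fin n) F) (X i) = p.1 := by
      rw [← hp']; exact φ.symm_apply_apply _
    rw [this]
    exact (mem_restrictTotalDegree _ _ _).1 p.2

end AffinePresentation

end

noncomputable section

namespace AffinePresentation

open MvPolynomial

variable {n : ℕ} {F : Type*} [Field F]

/-! ### Affine polynomials -/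

/-! The three families of relations hold among automorphisms, so evaluation `evalHom` maps the
presented group into the affine group. What remains is to show that its kernel is trivial and its
image is everything. Both follow by peeling off one variable at a time.

For a set S of indices let H_S be the subgroup of the presented group generated by the symbols with
index in S (`partialGroup`), and let m be a further index. An affine form L = a x_k + f, with a
nonzero and f free of x_k, is the value at x_m of the element σ(k, a, f)(km), and so determines the
coset σ(k, a, f)(km)H_S. The crux, `coset_eq`, is that this coset depends on L only and not on the
pivot k. Granting this, left multiplication by a generator σ(i, α, g) turns the coset of L into the
coset of σ(i, α, g)(L). If L involves x_i, take x_i as pivot and merge by relation 1; if not, the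
generator moves past σ(k, a, f) by relation 2 and past (km) by relation 3, ending in H_S.

Hence every w generated by the indices in S ∪ {m} lies in the coset of the form w(x_m)
(`exists_inCoset`). If w fixes x_m, this coset is H_S itself. An element of the kernel therefore
descends through all the H_S down to the trivial group. For surjectivity, an affine automorphism is
multiplied by the inverse of an element σ(k, a, f)(km) with the same value at x_m, so that x_m
becomes fixed as well. -/

theorem coeff_single_eq_zero {i : Fin n} {f : MvPolynomial (Fin n) F}
    (hf : f ∈ supported F ({i}ᶜ : Set (Fin n))) : coeff (Finsupp.single i 1) f = 0 := by
  by_contra h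
  have hi : i ∈ f.vars := (mem_vars_iff_mem_support i).2 ⟨_, mem_support_iff.2 h, by simp⟩
  exact mem_supported.1 hf hi rfl

/-- The linear part in `x_i` of a polynomial of degree at most one can be split off. -/
theorem notMem_vars_sub {f : MvPolynomial (Fin n) F} (hf : f.totalDegree ≤ 1) (i : Fin n) :
    i ∉ (f - C (coeff (Finsupp.single i 1) f) * X i).vars := by
  intro h
  obtain ⟨d, hd, hi⟩ := (mem_vars_iff_mem_support i).1 h
  have hdeg : (f - C (coeff (Finsupp.single i 1) f) * X i).totalDegree ≤ 1 :=
    (totalDegree_sub _ _).trans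
      (max_le hf ((totalDegree_C_mul_le _ _).trans (totalDegree_X _).le))
  have h1 : d.degree ≤ 1 := (le_totalDegree hd).trans hdeg
  -- A monomial of degree at most one that contains x_i is x_i itself, whose coefficient has been
  -- subtracted away.
  have hdi : d = Finsupp.single i 1 := by
    have h2 := Finsupp.le_degree i d
    have h3 : d i = 1 := by
      have : d i ≠ 0 := Finsupp.mem_support_iff.1 hi
      omega
    ext j
    rcases eq_or_ne j i with rfl | hj
    · simp [h3]
    · have h4 : d i + d j ≤ d.degree := by
        rw [Finsupp.degree_eq_sum, ← Finset.sum_pair hj.symm]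
        exact Finset.sum_le_sum_of_subset (Finset.subset_univ _)
      rw [Finsupp.single_eq_of_ne hj]
      omega
  rw [mem_support_iff] at hd
  apply hd
  rw [hdi, coeff_sub, coeff_C_mul, coeff_X, if_pos rfl, mul_one, sub_self]

theorem mem_supported_compl {s : Set (Fin n)} {f : MvPolynomial (Fin n) F} :
    f ∈ supported F sᶜ ↔ ∀ i ∈ s, i ∉ f.vars :=
  ⟨fun h _ hi hv => mem_supported.1 h hv hi,
    fun h => mem_supported.2 fun _ hv hi => h _ hi hv⟩

theorem isAffineOff_iff {i : Fin n} {f : MvPolynomial (Fin n) F} :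
    IsAffineOff i f ↔ i ∉ f.vars ∧ f.totalDegree ≤ 1 :=
  ⟨fun h => ⟨mem_supported_compl.1 h.1 i rfl, h.2⟩,
    fun h => ⟨mem_supported_compl.2 (by simpa using h.1), h.2⟩⟩

theorem isAffineOff_sub {f : MvPolynomial (Fin n) F} (hf : f.totalDegree ≤ 1) (i : Fin n) :
    IsAffineOff i (f - C (coeff (Finsupp.single i 1) f) * X i) :=
  isAffineOff_iff.2 ⟨notMem_vars_sub hf i, (totalDegree_sub _ _).trans
      (max_le hf ((totalDegree_C_mul_le _ _).trans (totalDegree_X _).le))⟩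

theorem IsAffineOff.add {i : Fin n} {f g : MvPolynomial (Fin n) F} (hf : IsAffineOff i f)
    (hg : IsAffineOff i g) : IsAffineOff i (f + g) := by
  simpa using hf.mul_add hg 1

theorem isAffineOff_zero (i : Fin n) : IsAffineOff i (0 : MvPolynomial (Fin n) F) :=
  ⟨zero_mem _, by simp⟩

theorem IsAffineOff.C_mul {i : Fin n} {f : MvPolynomial (Fin n) F} (hf : IsAffineOff i f)
    (c : F) : IsAffineOff i (C c * f) := by
  simpa using hf.mul_add (isAffineOff_zero i) c

theorem IsAffineOff.mem_pair {i j : Fin n} {f : MvPolynomial (Fin n) F} (hi : IsAffineOff i f)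
    (hj : IsAffineOff j f) : f ∈ supported F ({i, j}ᶜ : Set (Fin n)) := by
  rw [mem_supported_compl]
  rintro k (rfl | rfl)
  · exact (isAffineOff_iff.1 hi).1
  · exact (isAffineOff_iff.1 hj).1

theorem IsAffineOff.elemAut_eq {i : Fin n} {α : Fˣ} {f : MvPolynomial (Fin n) F}
    (hf : IsAffineOff i f) {g : MvPolynomial (Fin n) F} (hg : IsAffineOff i g) :
    elemAut i α f hf.1 g = g := by
  rw [elemAut_apply]
  exact aeval_eq_self (fun k hk => Function.update_of_ne hk _ _) hg.1

theorem elemAut_X_self (i : Fin n) (α : Fˣ) {f : MvPolynomial (Fin n) F}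
    (hf : f ∈ supported F ({i}ᶜ : Set (Fin n))) :
    elemAut i α f hf (X i) = C (α : F) * X i + f := by
  simp [elemAut_apply]

theorem elemAut_X_of_ne {i j : Fin n} (h : j ≠ i) (α : Fˣ) {f : MvPolynomial (Fin n) F}
    (hf : f ∈ supported F ({i}ᶜ : Set (Fin n))) :
    elemAut i α f hf (X j) = X j := by
  simp [elemAut_apply, Function.update_of_ne h]

theorem algEquiv_C (φ : MvPolynomial (Fin n) F ≃ₐ[F] MvPolynomial (Fin n) F) (c : F) :
    φ (C c) = C c := φ.commutes c

theorem algEquiv_ext {φ ψ : MvPolynomial (Fin n) F ≃ₐ[F] MvPolynomial (Fin n) F}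
    (h : ∀ i, φ (X i) = ψ (X i)) : φ = ψ := by
  ext p
  rw [algEquiv_eq_aeval φ, algEquiv_eq_aeval ψ]
  simp only [h]

/-! ### The relations hold for automorphisms -/

theorem AffineSymbol.toAut_mem (a : AffineSymbol n F) : a.toAut ∈ affineGroup n F := by
  intro j
  rcases eq_or_ne j a.idx with rfl | h
  · rw [AffineSymbol.toAut, elemAut_X_self]
    exact (totalDegree_add _ _).trans (max_le ((totalDegree_C_mul_le _ _).trans
      (totalDegree_X _).le) a.isAffineOff.2)
  · rw [AffineSymbol.toAut, elemAut_X_of_ne h]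
    exact (totalDegree_X _).le

/-- Automorphisms are compared on the variables, after the leading inverse in relations 2 and 3 has
been moved to the other side. -/
theorem Rel.lift_eq {u v : FreeGroup (AffineSymbol n F)} (h : Rel n F u v) :
    FreeGroup.lift AffineSymbol.toAut u = FreeGroup.lift AffineSymbol.toAut v := by
  cases h with
  | mul i α β f g hf hg =>
    simp only [gen, map_mul, FreeGroup.lift_apply_of, AffineSymbol.toAut]
    refine algEquiv_ext fun l => ?_
    rw [AlgEquiv.mul_apply]
    rcases eq_or_ne l i with rfl | hl
    · simp only [elemAut_X_self, map_add, map_mul, algEquiv_C, hf.elemAut_eq hg,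
        Units.val_mul]
      ring
    · simp only [elemAut_X_of_ne hl]
  | conj i j hij α β f g hf hg hfj =>
    have hfj' : IsAffineOff j f := ⟨supported_mono (by simp) hfj, hf.2⟩
    simp only [gen, map_mul, map_inv, FreeGroup.lift_apply_of, AffineSymbol.toAut]
    rw [mul_assoc, inv_mul_eq_iff_eq_mul]
    refine algEquiv_ext fun l => ?_
    rw [AlgEquiv.mul_apply, AlgEquiv.mul_apply]
    rcases eq_or_ne l j with rfl | hl
    · simp only [elemAut_X_of_ne hij.symm, elemAut_X_self, map_add, map_mul, algEquiv_C,
        add_right_inj]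
      rw [← AlgEquiv.mul_apply, mul_inv_cancel, AlgEquiv.one_apply]
    · rw [elemAut_X_of_ne hl]
      rcases eq_or_ne l i with rfl | hl'
      · simp only [elemAut_X_of_ne hij, elemAut_X_self, map_add, map_mul, algEquiv_C,
          hg.elemAut_eq hfj']
      · simp only [elemAut_X_of_ne hl, elemAut_X_of_ne hl']
  | swap k s h i j α f hf hj =>
    have hj' := hj
    rw [swapAut_X] at hj'
    obtain rfl := X_injective hj'
    simp only [gen, map_mul, map_inv, FreeGroup.lift_apply_of, AffineSymbol.toAut]
    change (swapAut F k s h)⁻¹ * _ * swapAut F k s h = _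
    rw [mul_assoc, inv_mul_eq_iff_eq_mul]
    have hinv : ∀ p, swapAut F k s h (swapAut F k s h p) = p := fun p => by
      have : swapAut F k s h * swapAut F k s h = 1 :=
        algEquiv_ext fun l => by simp [AlgEquiv.mul_apply, swapAut_X]
      exact DFunLike.congr_fun this p
    refine algEquiv_ext fun l => ?_
    rw [AlgEquiv.mul_apply, AlgEquiv.mul_apply, swapAut_X]
    rcases eq_or_ne l (Equiv.swap k s i) with rfl | hl
    · simp only [Equiv.swap_apply_self, elemAut_X_self, map_add, map_mul, algEquiv_C, swapAut_X,
        hinv]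
    · have hl' : Equiv.swap k s l ≠ i := fun hh => hl (by rw [← hh, Equiv.swap_apply_self])
      rw [elemAut_X_of_ne hl, elemAut_X_of_ne hl', swapAut_X]

/-! ### The presented group -/

/-- The group presented by the symbols and the relations between them. -/
abbrev Pres (n : ℕ) (F : Type*) [Field F] : Type _ := PresentedGroup (relators n F)

/-- The class of the symbol `σ(i, α, f)` in the presented group. -/
def elem (i : Fin n) (α : Fˣ) (f : MvPolynomial (Fin n) F) (hf : IsAffineOff i f) : Pres n F :=
  PresentedGroup.of ⟨i, α, f, hf⟩

/-- The class of the word `(ks)` in the presented group. -/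
def swapElem (k s : Fin n) (h : k ≠ s) : Pres n F :=
  PresentedGroup.mk (relators n F) (swapWord F k s h)

theorem elem_congr {i j : Fin n} {α β : Fˣ} {f g : MvPolynomial (Fin n) F}
    (hf : IsAffineOff i f) (hg : IsAffineOff j g) (hij : i = j) (hα : α = β) (hfg : f = g) :
    elem i α f hf = elem j β g hg := by
  subst hij hα hfg; rfl

theorem mk_eq_of_rel {u v : FreeGroup (AffineSymbol n F)} (h : Rel n F u v) :
    PresentedGroup.mk (relators n F) u = PresentedGroup.mk (relators n F) v := by
  rw [← mul_inv_eq_one, ← map_inv, ← map_mul]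
  exact PresentedGroup.one_of_mem ⟨u, v, h, rfl⟩

theorem elem_mul {i : Fin n} {α β : Fˣ} {f g : MvPolynomial (Fin n) F}
    (hf : IsAffineOff i f) (hg : IsAffineOff i g) :
    elem i α f hf * elem i β g hg = elem i (α * β) (C (β : F) * f + g) (hf.mul_add hg β) :=
  (map_mul (PresentedGroup.mk (relators n F)) _ _).symm.trans
    (mk_eq_of_rel (Rel.mul i α β f g hf hg))

theorem elem_one_zero (i : Fin n) : elem i (1 : Fˣ) 0 (isAffineOff_zero i) = 1 := by
  have h := elem_mul (α := (1 : Fˣ)) (β := 1) (isAffineOff_zero (F := F) i) (isAffineOff_zero i)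
  rw [elem_congr _ (isAffineOff_zero i) rfl (mul_one 1) (by simp)] at h
  exact mul_eq_left.1 h

theorem elem_inv {i : Fin n} {α : Fˣ} {f : MvPolynomial (Fin n) F} (hf : IsAffineOff i f) :
    (elem i α f hf)⁻¹ = elem i α⁻¹ (-(C ((α⁻¹ : Fˣ) : F) * f)) (hf.C_mul _).neg := by
  rw [inv_eq_iff_mul_eq_one, elem_mul, ← elem_one_zero i]
  exact elem_congr _ _ rfl (by simp) (by ring)

/-- Relation 2 as a rule for moving letters past each other. The new polynomial `g'` is supplied
together with a check by σ(i, α, f) itself, so no inverse automorphism has to be computed. -/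
theorem elem_mul_elem_of_ne {i j : Fin n} (hij : i ≠ j) {α β : Fˣ}
    {f g g' : MvPolynomial (Fin n) F} (hf : IsAffineOff i f) (hfj : IsAffineOff j f)
    (hg : IsAffineOff j g) (hg' : IsAffineOff j g') (h : elemAut i α f hf.1 g' = g) :
    elem j β g hg * elem i α f hf = elem i α f hf * elem j β g' hg' := by
  have h1 := mk_eq_of_rel (Rel.conj i j hij α β f g hf hg (hf.mem_pair hfj))
  rw [map_mul, map_mul, map_inv, mul_assoc, inv_mul_eq_iff_eq_mul] at h1
  refine h1.trans (congrArg (elem i α f hf * ·) (elem_congr _ hg' rfl rfl ?_))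
  rw [← h, ← AlgEquiv.mul_apply, inv_mul_cancel, AlgEquiv.one_apply]

theorem elem_mul_swapElem {k s : Fin n} (h : k ≠ s) {i j : Fin n} {α : Fˣ}
    {f g : MvPolynomial (Fin n) F} (hf : IsAffineOff i f) (hg : IsAffineOff j g)
    (hj : Equiv.swap k s i = j) (hfg : swapAut F k s h f = g) :
    elem i α f hf * swapElem k s h = swapElem k s h * elem j α g hg := by
  subst hj hfg
  have h1 := mk_eq_of_rel (Rel.swap k s h i _ α f hf (swapAut_X h i))
  rwa [map_mul, map_mul, map_inv, mul_assoc, inv_mul_eq_iff_eq_mul] at h1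

theorem swapElem_eq {k s : Fin n} (h : k ≠ s) : swapElem (F := F) k s h =
    elem s (-1) (X k) (isAffineOff_X h) * elem k 1 (-X s) (isAffineOff_X h.symm).neg *
    elem s 1 (X k) (isAffineOff_X h) := rfl

/-- Relation 3 applied to each of the three letters of (ab). -/
theorem swapElem_mul_swapElem {k s a b c d : Fin n} (h : k ≠ s) (hab : a ≠ b) (hcd : c ≠ d)
    (hc : Equiv.swap k s a = c) (hd : Equiv.swap k s b = d) :
    swapElem (F := F) a b hab * swapElem k s h = swapElem k s h * swapElem c d hcd := by
  rw [swapElem_eq hab, swapElem_eq hcd, mul_assoc,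
    elem_mul_swapElem h _ (isAffineOff_X hcd) hd (by rw [swapAut_X, hc]), mul_assoc,
    ← mul_assoc (elem a _ _ _),
    elem_mul_swapElem h _ (isAffineOff_X hcd.symm).neg hc (by rw [map_neg, swapAut_X, hd]),
    ← mul_assoc, ← mul_assoc,
    elem_mul_swapElem h _ (isAffineOff_X hcd) hd (by rw [swapAut_X, hc])]
  simp only [mul_assoc]

/-- Conjugating (ks) by itself leaves it unchanged, but by relation 3 also exchanges its two
indices. -/
theorem swapElem_symm {k s : Fin n} (h : k ≠ s) :
    swapElem (F := F) k s h = swapElem s k h.symm :=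
  mul_left_cancel (swapElem_mul_swapElem h h h.symm (Equiv.swap_apply_left _ _)
    (Equiv.swap_apply_right _ _))

theorem IsAffineOff.C_mul_X_add {i j : Fin n} (hij : i ≠ j) (c : F)
    {r : MvPolynomial (Fin n) F} (hr : IsAffineOff j r) : IsAffineOff j (C c * X i + r) :=
  (isAffineOff_X hij).mul_add hr c

theorem IsAffineOff.exists_eq {i k : Fin n} {f : MvPolynomial (Fin n) F} (hf : IsAffineOff k f)
    (h : i ≠ k) : ∃ (b : F) (r : MvPolynomial (Fin n) F), IsAffineOff k r ∧ IsAffineOff i r ∧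
      f = C b * X i + r := by
  refine ⟨coeff (Finsupp.single i 1) f, f - C (coeff (Finsupp.single i 1) f) * X i, ?_,
    isAffineOff_sub hf.2 i, (add_sub_cancel _ _).symm⟩
  rw [sub_eq_add_neg]
  exact hf.add ((isAffineOff_X h).C_mul _).neg

/-- Expand (kj) into its three letters. The first merges with σ(j, b, x_k + r) to give σ(j, -b, -r),
where x_k has cancelled; this passes the middle letter by relation 2 and merges with the last one.
-/
theorem elem_mul_swapElem_eq_one {k j : Fin n} (h : k ≠ j) (b : Fˣ)
    {r : MvPolynomial (Fin n) F} (hk : IsAffineOff k r) (hj : IsAffineOff j r) :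
    elem j b (X k + r) ((isAffineOff_X h).add hj) * swapElem k j h =
      elem k 1 (C (b : F) * X j + r) (hk.C_mul_X_add h.symm _) *
        elem j (-b) (X k + -r) ((isAffineOff_X h).add hj.neg) := by
  have key := elem_mul_elem_of_ne (β := (1 : Fˣ)) (α := -b) h.symm hj.neg hk.neg
    (hk.C_mul_X_add h.symm (b : F)) (isAffineOff_X h.symm).neg (by
      rw [map_neg, elemAut_X_self]
      simp [add_comm])
  have h1 : elem j b (X k + r) ((isAffineOff_X h).add hj) *
      elem j (-1) (X k) (isAffineOff_X h) = elem j (-b) (-r) hj.neg := by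
    rw [elem_mul]
    exact elem_congr _ _ rfl (by simp) (by simp)
  have h2 : elem j (-b) (X k + -r) ((isAffineOff_X h).add hj.neg) =
      elem j (-b) (-r) hj.neg * elem j 1 (X k) (isAffineOff_X h) := by
    rw [elem_mul]
    exact elem_congr _ _ rfl (by simp) (by simp [add_comm])
  rw [swapElem_eq, h2, ← mul_assoc, ← mul_assoc, h1, ← mul_assoc, key]

/-- Both σ(j, b, a x_k + r)(kj) and σ(k, a, b x_j + r) send x_k to a x_k + b x_j + r, so they should
differ by a factor fixing x_k. Scaling x_k by σ(k, a, 0) reduces this to the case a = 1. -/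
theorem elem_mul_swapElem_eq {k j : Fin n} (h : k ≠ j) (a b : Fˣ)
    {r : MvPolynomial (Fin n) F} (hk : IsAffineOff k r) (hj : IsAffineOff j r) :
    ∃ (c : Fˣ) (g : MvPolynomial (Fin n) F) (hg : IsAffineOff j g),
      elem j b (C (a : F) * X k + r) (hj.C_mul_X_add h _) * swapElem k j h =
        elem k a (C (b : F) * X j + r) (hk.C_mul_X_add h.symm _) * elem j c g hg := by
  have h1 := elem_mul_elem_of_ne (β := b) (α := a) h (isAffineOff_zero k) (isAffineOff_zero j)
    (hj.C_mul_X_add h (a : F)) ((isAffineOff_X h).add hj) (by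
      rw [map_add, elemAut_X_self, (isAffineOff_zero k).elemAut_eq hk, add_zero])
  have h2 := elem_mul_swapElem h (α := a) (isAffineOff_zero k) (isAffineOff_zero j)
    (Equiv.swap_apply_left _ _) (map_zero _)
  have h3 : elem k a (C (b : F) * X j + r) (hk.C_mul_X_add h.symm _) =
      elem k a 0 (isAffineOff_zero k) *
        elem k 1 (C (b : F) * X j + r) (hk.C_mul_X_add h.symm _) := by
    rw [elem_mul]
    exact elem_congr _ _ rfl (by simp) (by simp)
  have h4 : elem j b (C (a : F) * X k + r) (hj.C_mul_X_add h _) * swapElem k j h =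
      elem k a (C (b : F) * X j + r) (hk.C_mul_X_add h.symm _) *
        (elem j (-b) (X k + -r) ((isAffineOff_X h).add hj.neg) *
          (elem j a 0 (isAffineOff_zero j))⁻¹) := by
    rw [← mul_assoc, eq_mul_inv_iff_mul_eq, mul_assoc, ← h2, ← mul_assoc, h1, mul_assoc,
      elem_mul_swapElem_eq_one h b hk hj, ← mul_assoc, ← h3]
  rw [elem_inv, elem_mul] at h4
  exact ⟨_, _, _, h4⟩

/-! ### The subgroups generated by the symbols with index in a given set -/

/-- The subgroup generated by the `σ(i, α, f)` with `i ∈ S`. -/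
def partialGroup (F : Type*) [Field F] (S : Finset (Fin n)) : Subgroup (Pres n F) :=
  Subgroup.closure {x | ∃ i ∈ S, ∃ (α : Fˣ) (f : MvPolynomial (Fin n) F) (hf : IsAffineOff i f),
    x = elem i α f hf}

theorem elem_mem {S : Finset (Fin n)} {i : Fin n} (hi : i ∈ S) {α : Fˣ}
    {f : MvPolynomial (Fin n) F} (hf : IsAffineOff i f) : elem i α f hf ∈ partialGroup F S :=
  Subgroup.subset_closure ⟨i, hi, α, f, hf, rfl⟩

theorem swapElem_mem {S : Finset (Fin n)} {k s : Fin n} (hk : k ∈ S) (hs : s ∈ S) (h : k ≠ s) :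
    swapElem k s h ∈ partialGroup F S := by
  rw [swapElem_eq]
  exact mul_mem (mul_mem (elem_mem hs _) (elem_mem hk _)) (elem_mem hs _)

/-- Induction over the subgroup by left multiplication with generators. -/
theorem partialGroup_induction {S : Finset (Fin n)}
    {p : (w : Pres n F) → w ∈ partialGroup F S → Prop} (one : p 1 (one_mem _))
    (mul : ∀ (i : Fin n) (hi : i ∈ S) (α : Fˣ) (f : MvPolynomial (Fin n) F)
      (hf : IsAffineOff i f) (w : Pres n F) (hw : w ∈ partialGroup F S), p w hw →
        p (elem i α f hf * w) (mul_mem (elem_mem hi hf) hw)) {w : Pres n F}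
    (hw : w ∈ partialGroup F S) : p w hw := by
  induction hw using Subgroup.closure_induction_left with
  | one => exact one
  | mul_left x hx y hy ih =>
    obtain ⟨i, hi, α, f, hf, rfl⟩ := hx
    exact mul i hi α f hf y hy ih
  | inv_mul_cancel x hx y hy ih =>
    obtain ⟨i, hi, α, f, hf, rfl⟩ := hx
    simp only [elem_inv]
    exact mul i hi _ _ _ y hy ih

theorem partialGroup_univ : partialGroup F (Finset.univ : Finset (Fin n)) = ⊤ := by
  rw [eq_top_iff, ← PresentedGroup.closure_range_of]
  refine Subgroup.closure_mono ?_
  rintro _ ⟨a, rfl⟩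
  exact ⟨a.idx, Finset.mem_univ _, a.scale, a.poly, a.isAffineOff, rfl⟩

/-- The transposition `(km)`, or `1` if `k = m`. -/
def swapOrOne (F : Type*) [Field F] (m k : Fin n) : Pres n F :=
  if h : k = m then 1 else swapElem k m h

theorem swapOrOne_self (m : Fin n) : swapOrOne F m m = 1 := dif_pos rfl

theorem swapOrOne_of_ne {m k : Fin n} (h : k ≠ m) : swapOrOne F m k = swapElem k m h := dif_neg h

theorem swapOrOne_mem {S : Finset (Fin n)} {m k : Fin n} (hm : m ∈ S) (hk : k ∈ S) :
    swapOrOne F m k ∈ partialGroup F S := by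
  rcases eq_or_ne k m with rfl | h
  · rw [swapOrOne_self]; exact one_mem _
  · rw [swapOrOne_of_ne h]; exact swapElem_mem hk hm h

/-- Conjugation by (km) permutes the indices, and k is the only one sent to m. -/
theorem elem_mul_swapOrOne {m : Fin n} {S : Finset (Fin n)} {i k : Fin n}
    (hi : i ∈ insert m S) (hk : k ∈ insert m S) (hik : i ≠ k) {α : Fˣ}
    {f : MvPolynomial (Fin n) F} (hf : IsAffineOff i f) :
    (swapOrOne F m k)⁻¹ * elem i α f hf * swapOrOne F m k ∈ partialGroup F S := by
  rcases eq_or_ne k m with rfl | h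
  · rw [swapOrOne_self, inv_one, one_mul, mul_one]
    exact elem_mem (Finset.mem_of_mem_insert_of_ne hi hik) hf
  · rw [swapOrOne_of_ne h, mul_assoc, elem_mul_swapElem h hf (hf.swap h (swapAut_X h i)) rfl rfl,
      inv_mul_cancel_left]
    refine elem_mem ?_ _
    rcases eq_or_ne i m with rfl | him
    · rw [Equiv.swap_apply_right]
      exact Finset.mem_of_mem_insert_of_ne hk h
    · rw [Equiv.swap_apply_of_ne_of_ne hik him]
      exact Finset.mem_of_mem_insert_of_ne hi him

/-- For k ≠ m the factor is (kj), because (jm)(kj) = (kj)(km); for k = m it is 1. -/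
theorem exists_swapOrOne_mul {m : Fin n} {S : Finset (Fin n)} {j k : Fin n}
    (hj : j ∈ S) (hjm : j ≠ m) (hk : k ∈ insert m S) (h : k ≠ j) :
    ∃ x ∈ partialGroup F S, swapOrOne F m j * x = swapElem k j h * swapOrOne F m k := by
  rw [swapOrOne_of_ne hjm]
  rcases eq_or_ne k m with rfl | hkm
  · exact ⟨1, one_mem _, by rw [swapOrOne_self, swapElem_symm]⟩
  · refine ⟨_, swapElem_mem (Finset.mem_of_mem_insert_of_ne hk hkm) hj h, ?_⟩
    rw [swapOrOne_of_ne hkm]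
    exact swapElem_mul_swapElem h hjm hkm (Equiv.swap_apply_right _ _)
      (Equiv.swap_apply_of_ne_of_ne hkm.symm hjm.symm)

/-- Modulo H_S on the right, (jm) may be replaced by (kj)(km). The factor (kj) then changes the
pivot from j to k at the cost of some σ(j, c, g), and conjugation by (km) carries that letter into
H_S since j ≠ k. -/
theorem coset_eq_of_ne {m : Fin n} {S : Finset (Fin n)} {j k : Fin n}
    (hj : j ∈ S) (hjm : j ≠ m) (hk : k ∈ insert m S) (h : k ≠ j) (a b : Fˣ)
    {r : MvPolynomial (Fin n) F} (hrk : IsAffineOff k r) (hrj : IsAffineOff j r) :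
    (elem k a (C (b : F) * X j + r) (hrk.C_mul_X_add h.symm _) * swapOrOne F m k)⁻¹ *
      (elem j b (C (a : F) * X k + r) (hrj.C_mul_X_add h _) * swapOrOne F m j) ∈
      partialGroup F S := by
  obtain ⟨x, hx, hxe⟩ := exists_swapOrOne_mul hj hjm hk h (F := F)
  obtain ⟨c, g, hg, he⟩ := elem_mul_swapElem_eq h a b hrk hrj
  have h1 := mul_mem (elem_mul_swapOrOne (Finset.mem_insert_of_mem hj) hk h.symm hg (α := c))
    (inv_mem hx)
  convert h1 using 1
  rw [eq_mul_inv_iff_mul_eq, mul_assoc, mul_assoc, hxe, ← mul_assoc (elem j b _ _), he]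
  group

/-- The coset `σ(k, a, f) (km) H` for a linear form `a x_k + f` depends only on the form. -/
theorem coset_eq {m : Fin n} {S : Finset (Fin n)} {j k : Fin n}
    (hj : j ∈ insert m S) (hk : k ∈ insert m S) (h : k ≠ j) (a b : Fˣ)
    {r : MvPolynomial (Fin n) F} (hrk : IsAffineOff k r) (hrj : IsAffineOff j r) :
    (elem k a (C (b : F) * X j + r) (hrk.C_mul_X_add h.symm _) * swapOrOne F m k)⁻¹ *
      (elem j b (C (a : F) * X k + r) (hrj.C_mul_X_add h _) * swapOrOne F m j) ∈
      partialGroup F S := by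
  rcases eq_or_ne j m with rfl | hjm
  -- The statement is symmetric in j and k up to inversion, and k differs from m here.
  · have := inv_mem
      (coset_eq_of_ne (Finset.mem_of_mem_insert_of_ne hk h) h hj h.symm b a hrj hrk)
    rwa [mul_inv_rev, inv_inv] at this
  · exact coset_eq_of_ne (Finset.mem_of_mem_insert_of_ne hj hjm) hjm hk h a b hrk hrj

/-! ### Evaluation in the group of automorphisms -/

/-- The homomorphism that sends every symbol to the automorphism it denotes. -/
def evalHom (n : ℕ) (F : Type*) [Field F] :
    Pres n F →* (MvPolynomial (Fin n) F ≃ₐ[F] MvPolynomial (Fin n) F) :=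
  PresentedGroup.toGroup (f := AffineSymbol.toAut) (by
    rintro _ ⟨u, v, h, rfl⟩
    rw [map_mul, map_inv, h.lift_eq, mul_inv_cancel])

theorem evalHom_of (a : AffineSymbol n F) : evalHom n F (PresentedGroup.of a) = a.toAut :=
  PresentedGroup.toGroup.of _

theorem evalHom_elem {i : Fin n} {α : Fˣ} {f : MvPolynomial (Fin n) F} (hf : IsAffineOff i f) :
    evalHom n F (elem i α f hf) = elemAut i α f hf.1 := evalHom_of _

theorem evalHom_swapElem {k s : Fin n} (h : k ≠ s) :
    evalHom n F (swapElem k s h) = swapAut F k s h := by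
  simp only [swapElem_eq, map_mul, evalHom_elem, swapAut, swapWord, gen, FreeGroup.lift_apply_of,
    AffineSymbol.toAut]

theorem evalHom_swapOrOne_X (m k : Fin n) : evalHom n F (swapOrOne F m k) (X m) = X k := by
  rcases eq_or_ne k m with rfl | h
  · rw [swapOrOne_self, map_one, AlgEquiv.one_apply]
  · rw [swapOrOne_of_ne h, evalHom_swapElem, swapAut_X, Equiv.swap_apply_right]

theorem evalHom_X_of_notMem {S : Finset (Fin n)} {w : Pres n F} (hw : w ∈ partialGroup F S)
    {j : Fin n} (hj : j ∉ S) : evalHom n F w (X j) = X j := by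
  induction hw using partialGroup_induction with
  | one => rw [map_one, AlgEquiv.one_apply]
  | mul i hi α f hf w hw ih =>
    rw [map_mul, AlgEquiv.mul_apply, ih, evalHom_elem,
      elemAut_X_of_ne (by rintro rfl; exact hj hi)]

/-! ### Cosets of affine forms and injectivity -/

/-- The image of `x_m` under `w` is a form `a x_k + f`, and `w` lies in the coset of this form. -/
def InCoset (m : Fin n) (S : Finset (Fin n)) (w : Pres n F) (k : Fin n) : Prop :=
  ∃ (a : Fˣ) (f : MvPolynomial (Fin n) F) (hf : IsAffineOff k f),
    evalHom n F w (X m) = C (a : F) * X k + f ∧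
      (elem k a f hf * swapOrOne F m k)⁻¹ * w ∈ partialGroup F S

theorem InCoset.elem_mul_self {m : Fin n} {S : Finset (Fin n)} {w : Pres n F} {k : Fin n}
    (h : InCoset m S w k) {α : Fˣ} {g : MvPolynomial (Fin n) F} (hg : IsAffineOff k g) :
    InCoset m S (elem k α g hg * w) k := by
  obtain ⟨a, f, hf, he, hmem⟩ := h
  refine ⟨α * a, C (a : F) * g + f, hg.mul_add hf a, ?_, ?_⟩
  · rw [map_mul, AlgEquiv.mul_apply, he, evalHom_elem, map_add, map_mul, algEquiv_C,
      elemAut_X_self, hg.elemAut_eq hf, Units.val_mul, C_mul]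
    ring
  · rw [← elem_mul hg hf]
    convert hmem using 1
    group

theorem InCoset.elem_mul {m : Fin n} {S : Finset (Fin n)} {w : Pres n F} {k : Fin n}
    (hk : k ∈ insert m S) (h : InCoset m S w k) {i : Fin n} (hi : i ∈ insert m S) {α : Fˣ}
    {g : MvPolynomial (Fin n) F} (hg : IsAffineOff i g) :
    ∃ k ∈ insert m S, InCoset m S (elem i α g hg * w) k := by
  rcases eq_or_ne k i with rfl | hki
  · exact ⟨k, hk, h.elem_mul_self hg⟩
  obtain ⟨a, f, hf, he, hmem⟩ := h
  obtain ⟨b, r, hrk, hri, rfl⟩ := hf.exists_eq hki.symm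
  rcases eq_or_ne b 0 with rfl | hb
  · have hfi : IsAffineOff i (C 0 * X i + r) := by simpa using hri
    refine ⟨k, hk, a, _, hf, ?_, ?_⟩
    · rw [map_mul, AlgEquiv.mul_apply, he, evalHom_elem, map_add, map_mul, algEquiv_C,
        elemAut_X_of_ne hki, hg.elemAut_eq hfi]
    · have h1 : IsAffineOff i (elemAut k a _ hf.1 |>.symm g) := hf.conj hki a (hf.mem_pair hfi) hg
      have h2 := elem_mul_elem_of_ne (β := α) (α := a) hki hf hfi hg h1
        (AlgEquiv.apply_symm_apply _ _)
      have h3 := mul_mem (elem_mul_swapOrOne hi hk hki.symm h1 (α := α)) hmem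
      convert h3 using 1
      rw [inv_mul_eq_iff_eq_mul, mul_inv_rev]
      simp only [mul_assoc, mul_inv_cancel_left]
      rw [← mul_assoc (elem k a _ _), ← h2]
      simp only [mul_assoc, mul_inv_cancel_left]
  · obtain ⟨b, rfl⟩ := hb.isUnit
    -- Here x_i occurs in the form with a unit coefficient, so `coset_eq` allows x_i to replace x_k
    -- as pivot, and relation 1 finishes.
    refine ⟨i, hi, InCoset.elem_mul_self ⟨b, _, hri.C_mul_X_add hki (a : F), ?_, ?_⟩ hg⟩
    · rw [he]; ring
    · convert mul_mem (inv_mem (coset_eq hi hk hki a b hrk hri)) hmem using 1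
      group

theorem exists_inCoset {m : Fin n} {S : Finset (Fin n)} {w : Pres n F}
    (hw : w ∈ partialGroup F (insert m S)) : ∃ k ∈ insert m S, InCoset m S w k := by
  induction hw using partialGroup_induction with
  | one =>
    refine ⟨m, Finset.mem_insert_self _ _, 1, 0, isAffineOff_zero m, by simp, ?_⟩
    rw [elem_one_zero, swapOrOne_self]
    simp [one_mem]
  | mul i hi α f hf w hw ih =>
    obtain ⟨k, hk, h⟩ := ih
    exact h.elem_mul hk hi hf

/-- An equation x_m = a x_k + f with f free of x_k forces k = m, a = 1 and f = 0, and the coset of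
that form is the subgroup itself. -/
theorem mem_partialGroup_of_fixed {m : Fin n} {S : Finset (Fin n)} {w : Pres n F}
    (hw : w ∈ partialGroup F (insert m S)) (h : evalHom n F w (X m) = X m) :
    w ∈ partialGroup F S := by
  obtain ⟨k, hk, a, f, hf, he, hmem⟩ := exists_inCoset hw
  rw [h] at he
  have h1 := congrArg (coeff (Finsupp.single k 1)) he
  rw [coeff_add, coeff_C_mul, coeff_single_eq_zero hf.1, add_zero,
    coeff_X_same, mul_one] at h1
  have hmk : m = k := by
    by_contra hne
    rw [coeff_X, if_neg] at h1
    · exact a.ne_zero h1.symm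
    · simpa [Finsupp.single_left_inj] using hne
  subst hmk
  rw [coeff_X_same] at h1
  obtain rfl : a = 1 := Units.ext h1.symm
  have hf0 : f = 0 := by simpa using he
  subst hf0
  rwa [elem_one_zero, swapOrOne_self, one_mul, inv_one, one_mul] at hmem

theorem eq_one_of_evalHom_eq_one (S : Finset (Fin n)) {w : Pres n F}
    (hw : w ∈ partialGroup F S) (h : evalHom n F w = 1) : w = 1 := by
  induction S using Finset.induction_on with
  | empty =>
    induction hw using partialGroup_induction with
    | one => rfl
    | mul i hi => simp at hi
  | insert m S hm ih => exact ih (mem_partialGroup_of_fixed hw (by rw [h, AlgEquiv.one_apply]))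

theorem evalHom_injective : Function.Injective (evalHom n F) :=
  (injective_iff_map_eq_one _).2 fun w h =>
    eq_one_of_evalHom_eq_one Finset.univ (partialGroup_univ (F := F) ▸ Subgroup.mem_top w) h

theorem evalHom_mem (w : Pres n F) : evalHom n F w ∈ affineGroup n F := by
  have hw : w ∈ partialGroup F Finset.univ := partialGroup_univ (F := F) ▸ Subgroup.mem_top w
  induction hw using partialGroup_induction with
  | one => rw [map_one]; exact one_mem _
  | mul i hi α f hf w hw ih =>
    rw [map_mul]
    exact mul_mem (by rw [elem, evalHom_of]; exact AffineSymbol.toAut_mem _) ih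

/-! ### Surjectivity -/

/-- Affine automorphisms that fix all `x_j` with `j ∉ S` are products of elementary ones. -/
theorem exists_evalHom_eq (S : Finset (Fin n)) :
    ∀ φ ∈ affineGroup n F, (∀ j ∉ S, φ (X j) = X j) → ∃ w : Pres n F, evalHom n F w = φ := by
  induction S using Finset.induction_on with
  | empty =>
    intro φ _ h
    exact ⟨1, by rw [map_one]; exact algEquiv_ext fun i => (h i (by simp)).symm⟩
  | insert m S hm ih =>
    intro φ hφ h
    obtain ⟨k, hk, hc⟩ : ∃ k ∈ insert m S, coeff (Finsupp.single k 1) (φ (X m)) ≠ 0 := by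
      -- Otherwise φ(x_m) is a polynomial in variables fixed by φ, so φ fixes φ(x_m). Injectivity
      -- gives φ(x_m) = x_m, but x_m is not among those variables.
      by_contra! hcon
      have h1 : φ (X m) ∈ supported F ((insert m S : Finset (Fin n)) : Set (Fin n))ᶜ := by
        refine mem_supported_compl.2 fun i hi => ?_
        have := notMem_vars_sub (hφ m) i
        rwa [hcon i hi, C_0, zero_mul, sub_zero] at this
      have h2 : φ (φ (X m)) = φ (X m) := by
        conv_lhs => rw [algEquiv_eq_aeval]
        exact aeval_eq_self (fun j hj => h j (by simpa using hj)) h1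
      rw [φ.injective h2] at h1
      exact X_mem_supported.1 h1 (by simp)
    -- Under `t` the variable x_m goes to x_k by (km) and then to the form φ(x_m); variables outside
    -- S ∪ {m} stay fixed. Thus t⁻¹φ also fixes x_m.
    set t : Pres n F := elem k (Units.mk0 _ hc) _ (isAffineOff_sub (hφ m) k) * swapOrOne F m k
      with ht
    have htmem : t ∈ partialGroup F (insert m S) :=
      mul_mem (elem_mem hk _) (swapOrOne_mem (Finset.mem_insert_self _ _) hk)
    have htm : evalHom n F t (X m) = φ (X m) := by
      rw [ht, map_mul, AlgEquiv.mul_apply, evalHom_swapOrOne_X, evalHom_elem, elemAut_X_self,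
        Units.val_mk0, add_sub_cancel]
    obtain ⟨w, hw⟩ := ih ((evalHom n F t)⁻¹ * φ) (mul_mem (inv_mem (evalHom_mem t)) hφ)
      fun j hj => by
        rw [AlgEquiv.mul_apply]
        refine (AlgEquiv.symm_apply_eq (evalHom n F t)).2 ?_
        rcases eq_or_ne j m with rfl | hjm
        · exact htm.symm
        · have hj' : j ∉ insert m S := by simp [hj, hjm]
          rw [h j hj', evalHom_X_of_notMem htmem hj']
    exact ⟨t * w, by rw [map_mul, hw, mul_inv_cancel_left]⟩

end AffinePresentation

end

theorem mainTheorem4 (n : ℕ) (F : Type*) [Field F] :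
    ∃ e : PresentedGroup (AffinePresentation.relators n F) ≃*
        AffinePresentation.affineGroup n F,
      ∀ a : AffinePresentation.AffineSymbol n F,
        ((e (PresentedGroup.of a) : AffinePresentation.affineGroup n F) :
          MvPolynomial (Fin n) F ≃ₐ[F] MvPolynomial (Fin n) F) = a.toAut := by
  have hmem : ∀ w, AffinePresentation.evalHom n F w ∈ AffinePresentation.affineGroup n F :=
    AffinePresentation.evalHom_mem
  let e := (AffinePresentation.evalHom n F).codRestrict _ hmem
  have he : Function.Bijective e :=
    ⟨fun v w h => AffinePresentation.evalHom_injective (congrArg Subtype.val h), fun φ => by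
      obtain ⟨w, hw⟩ := AffinePresentation.exists_evalHom_eq Finset.univ φ.1 φ.2 (by simp)
      exact ⟨w, Subtype.ext hw⟩⟩
  exact ⟨MulEquiv.ofBijective e he, AffinePresentation.evalHom_of⟩
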